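/- Let $\varphi:\mathbb{R}^2\to\mathbb{R}$ be a smooth radial function supported in $\{\frac12\le|\xi|\le 2\}$ with $\sum_{j\in\mathbb{Z}}\varphi(2^{-j}\xi)=1$ for all $\xi\neq0$. For $g\in C_c^\infty(\mathbb{R}^2)$ (complex-valued) put $\hat g(\xi)=(2\pi)^{-2}\int_{\mathbb{R}^2}e^{-ix\cdot\xi}g(x)\,dx$, so that $g(x)=\int_{\mathbb{R}^2}e^{ix\cdot\xi}\hat g(\xi)\,d\xi$, and let $$e^{L_1t}g(x)=\int_{\mathbb{R}^2}e^{ix\cdot\xi-it\frac{\xi_1}{|\xi|^2}}\,\hat g(\xi)\,d\xi .$$ Let $P_j$, $j\in\mathbb{Z}$, be the Littlewood-Paley projectors $\widehat{P_jg}(\xi)=\varphi(2^{-j}\xi)\hat g(\xi)$, and let $\|g\|_{\dot B^3_{1,1}}=\sum_{j\in\mathbb{Z}}2^{3j}\|P_jg\|_{L^1}$. Then there is a constant $C>0$, depending only on $\varphi$, such that for every $g\in C_c^\infty(\mathbb{R}^2)$ and every $t>0$ $$\|e^{L_1t}g\|_{L^\infty}\le C\,t^{-1}\,\|g\|_{\dot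 B^3_{1,1}} .$$ -/

import Mathlib

open MeasureTheory
open scoped ENNReal ContDiff

namespace BetaPlane

/-- The Euclidean plane `ℝ²`. -/
abbrev Plane : Type := EuclideanSpace ℝ (Fin 2)

/-- The Fourier transform, normalised as
`ĝ(ξ) = (2π)⁻² ∫ e^{-i x·ξ} g(x) dx`, so that `g(x) = ∫ e^{i x·ξ} ĝ(ξ) dξ`. -/
noncomputable def fourierHat (g : Plane → ℂ) (ξ : Plane) : ℂ :=
  (((2 * Real.pi) ^ 2)⁻¹ : ℂ) *
    ∫ x : Plane, Complex.exp (-Complex.I * ((inner ℝ x ξ : ℝ) : ℂ)) * g x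

/-- The inverse Fourier transform belonging to `fourierHat`:
`h ↦ (x ↦ ∫ e^{i x·ξ} h(ξ) dξ)`. -/
noncomputable def fourierInv (h : Plane → ℂ) (x : Plane) : ℂ :=
  ∫ ξ : Plane, Complex.exp (Complex.I * ((inner ℝ x ξ : ℝ) : ℂ)) * h ξ

/-- The linear semigroup
`(e^{L₁ t} g)(x) = ∫ e^{i x·ξ - i t ξ₁ / |ξ|²} ĝ(ξ) dξ`.
The value of the phase at the single point `ξ = 0` is irrelevant. -/
noncomputable def semigroup (t : ℝ) (g : Plane → ℂ) (x : Plane) : ℂ :=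
  ∫ ξ : Plane,
    Complex.exp (Complex.I * ((inner ℝ x ξ : ℝ) : ℂ)
      - Complex.I * ((t * (ξ 0 / ‖ξ‖ ^ 2) : ℝ) : ℂ)) * fourierHat g ξ

/-- A Littlewood-Paley bump function on `ℝ²`: a smooth radial function supported in the shell
`1/2 ≤ |ξ| ≤ 2` whose dyadic rescalings form a partition of unity away from the origin. -/
structure IsLittlewoodPaleyBump (φ : Plane → ℝ) : Prop where
  smooth : ContDiff ℝ ∞ φ
  radial : ∀ ξ η : Plane, ‖ξ‖ = ‖η‖ → φ ξ = φ η
  support_subset : Function.support φ ⊆ {ξ : Plane | 1 / 2 ≤ ‖ξ‖ ∧ ‖ξ‖ ≤ 2}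
  hasSum_one : ∀ ξ : Plane, ξ ≠ 0 → HasSum (fun j : ℤ => φ ((2 : ℝ) ^ (-j) • ξ)) 1

/-- The Littlewood-Paley projector `P_j`: `(P_j g)^(ξ) = φ(2^{-j} ξ) ĝ(ξ)`. -/
noncomputable def lpProj (φ : Plane → ℝ) (j : ℤ) (g : Plane → ℂ) : Plane → ℂ :=
  fourierInv fun ξ => ((φ ((2 : ℝ) ^ (-j) • ξ) : ℝ) : ℂ) * fourierHat g ξ

/-- The homogeneous Besov norm `‖ (2^{s j} ‖P_j g‖_{L^p})_{j ∈ ℤ} ‖_{ℓ^q}`, with values in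
`[0, ∞]`; the `ℓ^q` norm is the `L^q` norm for the counting measure on `ℤ`. -/
noncomputable def besovNorm (φ : Plane → ℝ) (s : ℝ) (p q : ℝ≥0∞) (g : Plane → ℂ) : ℝ≥0∞ :=
  eLpNorm (fun j : ℤ => (2 : ℝ≥0∞) ^ (s * (j : ℝ)) * eLpNorm (lpProj φ j g) p volume)
    q Measure.count

end BetaPlane

/-!
Identify `ℝ²` with `ℂ`, rescale the frequency shell `|ξ| ~ 2 ^ j` to unit size and write the phase
as `s Re f` with `f z = w z - z⁻¹` and `s = t 2 ^ (-j)`, so that `f` is holomorphic with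
derivative `p z = w + z⁻²`. Integrating by parts twice in `∂ = (∂₁ - i ∂₂) / 2`, with the inverse of
`p` regularised at the scale `s ^ (-1/2)`, bounds the oscillatory integral by that of
`(1 + s |p|²)⁻²`. On the shell `|p|` controls the distance to the two square roots of `-w⁻¹`,
uniformly in `w`, so the integral is `O(s⁻¹)`. The localised kernels are therefore
`O(t⁻¹ 2 ^ (3 j))` uniformly in space, Parseval's identity turns this into an `L¹ → L^∞` bound
for each Littlewood-Paley piece, and the pieces are summed.
-/

namespace BetaPlane

open Set Metric ComplexConjugate

section Wirtinger

variable {h k : ℂ → ℂ} {c d z : ℂ}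

/-- `h` is real differentiable at `z` and its Wirtinger derivative `∂h = (∂₁h - i ∂₂h) / 2` there
is `d`. -/
def HasWirtingerDerivAt (h : ℂ → ℂ) (d z : ℂ) : Prop :=
  ∃ L : ℂ →L[ℝ] ℂ, HasFDerivAt h L z ∧ (L 1 - Complex.I * L Complex.I) / 2 = d

/-- The Wirtinger derivative `∂h = (∂₁h - i ∂₂h) / 2`, with the junk value `0` where `h` is not
real differentiable. -/
noncomputable def wirtingerDeriv (h : ℂ → ℂ) (z : ℂ) : ℂ :=
  (fderiv ℝ h z 1 - Complex.I * fderiv ℝ h z Complex.I) / 2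

namespace HasWirtingerDerivAt

theorem wirtingerDeriv_eq (hh : HasWirtingerDerivAt h d z) : wirtingerDeriv h z = d := by
  obtain ⟨L, hL, rfl⟩ := hh
  rw [wirtingerDeriv, hL.fderiv]

theorem add (hh : HasWirtingerDerivAt h c z) (hk : HasWirtingerDerivAt k d z) :
    HasWirtingerDerivAt (fun x ↦ h x + k x) (c + d) z := by
  obtain ⟨L, hL, rfl⟩ := hh
  obtain ⟨M, hM, rfl⟩ := hk
  refine ⟨L + M, hL.add hM, ?_⟩
  simp only [add_apply]
  ring

theorem mul (hh : HasWirtingerDerivAt h c z) (hk : HasWirtingerDerivAt k d z) :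
    HasWirtingerDerivAt (fun x ↦ h x * k x) (c * k z + h z * d) z := by
  obtain ⟨L, hL, rfl⟩ := hh
  obtain ⟨M, hM, rfl⟩ := hk
  refine ⟨h z • M + k z • L, hL.mul hM, ?_⟩
  simp only [add_apply, smul_apply, smul_eq_mul]
  ring

theorem comp {G : ℂ → ℂ} (hG : HasDerivAt G c (h z)) (hh : HasWirtingerDerivAt h d z) :
    HasWirtingerDerivAt (fun x ↦ G (h x)) (c * d) z := by
  obtain ⟨L, hL, rfl⟩ := hh
  refine ⟨_, (hG.hasFDerivAt.restrictScalars ℝ).comp z hL, ?_⟩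
  simp only [ContinuousLinearMap.coe_comp, Function.comp_apply,
    ContinuousLinearMap.coe_restrictScalars', ContinuousLinearMap.toSpanSingleton_apply,
    smul_eq_mul]
  ring

theorem const_mul (c : ℂ) (hh : HasWirtingerDerivAt h d z) :
    HasWirtingerDerivAt (fun x ↦ c * h x) (c * d) z := by
  simpa using comp ((hasDerivAt_id (h z)).const_mul c) hh

end HasWirtingerDerivAt

theorem hasWirtingerDerivAt_wirtingerDeriv (hh : DifferentiableAt ℝ h z) :
    HasWirtingerDerivAt h (wirtingerDeriv h z) z :=
  ⟨_, hh.hasFDerivAt, rfl⟩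

theorem hasWirtingerDerivAt_of_hasDerivAt (hh : HasDerivAt h d z) :
    HasWirtingerDerivAt h d z := by
  refine ⟨_, hh.hasFDerivAt.restrictScalars ℝ, ?_⟩
  simp only [ContinuousLinearMap.coe_restrictScalars', ContinuousLinearMap.toSpanSingleton_apply,
    smul_eq_mul]
  linear_combination (-d / 2) * Complex.I_mul_I

theorem hasWirtingerDerivAt_conj_of_hasDerivAt (hh : HasDerivAt h d z) :
    HasWirtingerDerivAt (fun x ↦ conj (h x)) 0 z := by
  refine ⟨_, Complex.conjCLE.hasFDerivAt.comp z (hh.hasFDerivAt.restrictScalars ℝ), ?_⟩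
  simp only [ContinuousLinearMap.coe_comp, Function.comp_apply,
    ContinuousLinearMap.coe_restrictScalars', ContinuousLinearMap.toSpanSingleton_apply,
    smul_eq_mul, ContinuousLinearEquiv.coe_coe, Complex.conjCLE_apply, map_mul, Complex.conj_I,
    map_one]
  linear_combination (conj d / 2) * Complex.I_mul_I

theorem contDiff_wirtingerDeriv {m n : WithTop ℕ∞} (hh : ContDiff ℝ n h) (hmn : m + 1 ≤ n) :
    ContDiff ℝ m (wirtingerDeriv h) := by
  have := hh.fderiv_right hmn
  unfold wirtingerDeriv
  fun_prop

theorem tsupport_wirtingerDeriv_subset : tsupport (wirtingerDeriv h) ⊆ tsupport h := by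
  refine closure_minimal (fun z hz ↦ ?_) (isClosed_tsupport h)
  by_contra hzh
  exact hz (by simp [wirtingerDeriv, fderiv_of_notMem_tsupport ℝ hzh])

theorem integrable_fderiv_apply {E F : Type*} [NormedAddCommGroup E] [NormedSpace ℝ E]
    [MeasurableSpace E] [BorelSpace E] [NormedAddCommGroup F] [NormedSpace ℝ F]
    {μ : Measure E} [IsFiniteMeasureOnCompacts μ] {u : E → F}
    (hu : ContDiff ℝ 1 u) (huc : HasCompactSupport u) (v : E) :
    Integrable (fun x ↦ fderiv ℝ u x v) μ := by
  have := hu.continuous_fderiv one_ne_zero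
  exact Continuous.integrable_of_hasCompactSupport (by fun_prop) (huc.fderiv_apply ℝ v)

theorem integral_fderiv_apply_eq_zero {E : Type*} [NormedAddCommGroup E] [NormedSpace ℝ E]
    [FiniteDimensional ℝ E] [MeasurableSpace E] [BorelSpace E] {μ : Measure E}
    [μ.IsAddHaarMeasure] {u : E → ℂ} (hu : ContDiff ℝ 1 u) (huc : HasCompactSupport u) (v : E) :
    ∫ x, fderiv ℝ u x v ∂μ = 0 := by
  simpa using (integral_mul_fderiv_eq_neg_fderiv_mul_of_integrable (μ := μ)
    (f := u) (g := fun _ ↦ (1 : ℂ)) (v := v)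
    (by simpa using integrable_fderiv_apply hu huc v) (by simp)
    (by simpa using hu.continuous.integrable_of_hasCompactSupport huc)
    (fun x _ ↦ hu.differentiable one_ne_zero x) (fun x _ ↦ differentiableAt_const _)).symm

theorem integrable_wirtingerDeriv (hh : ContDiff ℝ 1 h) (hc : HasCompactSupport h) :
    Integrable (wirtingerDeriv h) :=
  ((integrable_fderiv_apply hh hc 1).sub
    ((integrable_fderiv_apply hh hc Complex.I).const_mul Complex.I)).div_const 2

theorem integral_wirtingerDeriv_eq_zero (hh : ContDiff ℝ 1 h) (hc : HasCompactSupport h) :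
    ∫ z, wirtingerDeriv h z = 0 := by
  simp only [wirtingerDeriv]
  rw [integral_div, integral_sub (integrable_fderiv_apply hh hc 1)
    ((integrable_fderiv_apply hh hc Complex.I).const_mul Complex.I), integral_const_mul,
    integral_fderiv_apply_eq_zero hh hc, integral_fderiv_apply_eq_zero hh hc]
  simp

end Wirtinger

section IntegrationByParts

variable {s : ℝ} {f p u : ℂ → ℂ} {z : ℂ}

/-- The oscillating factor `e^{i s Re f(z)}`. -/
noncomputable def phaseFactor (s : ℝ) (f : ℂ → ℂ) (z : ℂ) : ℂ :=
  Complex.exp (Complex.I * ((s * (f z).re : ℝ) : ℂ))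

/-- The weight `(1 + s |p|²)⁻¹`, which localises to the `s^{-1/2}`-neighbourhood of the zeros of
the phase derivative `p`. -/
noncomputable def weight (s : ℝ) (p : ℂ → ℂ) (z : ℂ) : ℝ := (1 + s * ‖p z‖ ^ 2)⁻¹

/-- The regularisation `p̄ / (1 + s |p|²)` of `(s p)⁻¹`, smooth across the zeros of `p`. -/
noncomputable def regInv (s : ℝ) (p : ℂ → ℂ) (z : ℂ) : ℂ := weight s p z * conj (p z)

/-- The zeroth order coefficient of `ibpAdjoint`. -/
noncomputable def ibpCoeff (s : ℝ) (p : ℂ → ℂ) (z : ℂ) : ℂ :=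
  weight s p z - 2 * Complex.I * s * deriv p z * regInv s p z ^ 2

/-- The operator `u ↦ r u + 2 i ∂(W u)` with `r = weight s p` and `W = regInv s p`, written out
using `∂W = - s p' W²`. It is the transpose of `r - 2 i W ∂`, which fixes `e^{i s Re f}` when
`f' = p`. -/
noncomputable def ibpAdjoint (s : ℝ) (p u : ℂ → ℂ) (z : ℂ) : ℂ :=
  ibpCoeff s p z * u z + 2 * Complex.I * regInv s p z * wirtingerDeriv u z

theorem norm_phaseFactor : ‖phaseFactor s f z‖ = 1 := by
  rw [phaseFactor, mul_comm, Complex.norm_exp_ofReal_mul_I]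

theorem weight_pos (hs : 0 ≤ s) : 0 < weight s p z := by
  unfold weight
  positivity

theorem weight_le_one (hs : 0 ≤ s) : weight s p z ≤ 1 :=
  inv_le_one_of_one_le₀ (le_add_of_nonneg_right (by positivity))

theorem norm_regInv (hs : 0 ≤ s) : ‖regInv s p z‖ = weight s p z * ‖p z‖ := by
  rw [regInv, norm_mul, Complex.norm_conj, Complex.norm_real,
    Real.norm_of_nonneg (weight_pos hs).le]

theorem mul_norm_regInv_sq_le_weight (hs : 0 ≤ s) :
    s * ‖regInv s p z‖ ^ 2 ≤ weight s p z := by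
  have hle : s * ‖p z‖ ^ 2 * weight s p z ≤ 1 :=
    (div_le_one (by positivity)).2 (le_add_of_nonneg_left zero_le_one)
  calc s * ‖regInv s p z‖ ^ 2 = s * ‖p z‖ ^ 2 * weight s p z * weight s p z := by
        rw [norm_regInv hs]; ring
    _ ≤ 1 * weight s p z := by gcongr; exact (weight_pos hs).le
    _ = weight s p z := one_mul _

theorem one_add_mul_mul_conj_ne_zero (hs : 0 ≤ s) (a : ℂ) : 1 + s * (a * conj a) ≠ 0 := by
  rw [Complex.mul_conj, Complex.normSq_eq_norm_sq]
  norm_cast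
  positivity

theorem weight_eq_inv : (weight s p z : ℂ) = (1 + s * (p z * conj (p z)))⁻¹ := by
  rw [weight, Complex.mul_conj, Complex.normSq_eq_norm_sq]
  push_cast
  rfl

theorem weight_eq_one_sub (hs : 0 ≤ s) :
    (weight s p z : ℂ) = 1 - s * p z * regInv s p z := by
  rw [regInv, weight_eq_inv]
  linear_combination inv_mul_cancel₀ (one_add_mul_mul_conj_ne_zero hs (p z))

theorem hasWirtingerDerivAt_phaseFactor (hf : HasDerivAt f (p z) z) :
    HasWirtingerDerivAt (phaseFactor s f)
      (Complex.I * s / 2 * p z * phaseFactor s f z) z := by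
  have heq : phaseFactor s f = fun z ↦ Complex.exp (Complex.I * s / 2 * (f z + conj (f z))) := by
    funext z
    rw [phaseFactor, Complex.add_conj]
    push_cast
    ring_nf
  have hre := (hasWirtingerDerivAt_of_hasDerivAt hf).add (hasWirtingerDerivAt_conj_of_hasDerivAt hf)
  convert HasWirtingerDerivAt.comp (Complex.hasDerivAt_exp _)
    (hre.const_mul (Complex.I * s / 2)) using 1
  rw [heq]
  ring

theorem hasWirtingerDerivAt_weight (hs : 0 ≤ s) (hp : AnalyticAt ℂ p z) :
    HasWirtingerDerivAt (fun z ↦ (weight s p z : ℂ))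
      (-s * deriv p z * regInv s p z * weight s p z) z := by
  have hp' := hp.differentiableAt.hasDerivAt
  have hsq := (hasWirtingerDerivAt_of_hasDerivAt hp').mul
    (hasWirtingerDerivAt_conj_of_hasDerivAt hp')
  have hinv : HasDerivAt (fun x : ℂ ↦ (1 + s * x)⁻¹)
      (-s * (1 + s * (p z * conj (p z)))⁻¹ ^ 2) (p z * conj (p z)) := by
    refine ((((hasDerivAt_id _).const_mul (s : ℂ)).const_add 1).inv
      (one_add_mul_mul_conj_ne_zero hs (p z))).congr_deriv ?_
    rw [mul_one, inv_pow, div_eq_mul_inv, id]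
  simp only [regInv, weight_eq_inv]
  convert HasWirtingerDerivAt.comp (h := fun z ↦ p z * conj (p z)) hinv hsq using 1
  ring

theorem hasWirtingerDerivAt_regInv (hs : 0 ≤ s) (hp : AnalyticAt ℂ p z) :
    HasWirtingerDerivAt (regInv s p) (-s * deriv p z * regInv s p z ^ 2) z := by
  convert (hasWirtingerDerivAt_weight hs hp).mul
    (hasWirtingerDerivAt_conj_of_hasDerivAt hp.differentiableAt.hasDerivAt) using 1
  · rfl
  · rw [regInv]
    ring

theorem hasWirtingerDerivAt_ibpCoeff (hs : 0 ≤ s) (hp : AnalyticAt ℂ p z) :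
    HasWirtingerDerivAt (ibpCoeff s p)
      (-s * deriv p z * regInv s p z * weight s p z
        - 2 * Complex.I * s * deriv (deriv p) z * regInv s p z ^ 2
        + 4 * Complex.I * s ^ 2 * deriv p z ^ 2 * regInv s p z ^ 3) z := by
  have hp'' := hasWirtingerDerivAt_of_hasDerivAt hp.deriv.differentiableAt.hasDerivAt
  have hW := hasWirtingerDerivAt_regInv hs hp
  convert (hasWirtingerDerivAt_weight hs hp).add
    ((hp''.mul (hW.mul hW)).const_mul (-2 * Complex.I * s)) using 1
  · funext z
    rw [ibpCoeff]
    ring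
  · ring

variable {U : Set ℂ}

theorem analyticAt_of_hasDerivAt (hU : IsOpen U) (hf : ∀ z ∈ U, HasDerivAt f (p z) z)
    (hz : z ∈ U) : AnalyticAt ℂ p z := by
  have hd : DifferentiableOn ℂ f U :=
    fun y hy ↦ (hf y hy).differentiableAt.differentiableWithinAt
  refine (hd.analyticAt (hU.mem_nhds hz)).deriv.congr ?_
  filter_upwards [hU.mem_nhds hz] with y hy using (hf y hy).deriv

theorem contDiffAt_phaseFactor (hf : AnalyticAt ℂ f z) {n : WithTop ℕ∞} :
    ContDiffAt ℝ n (phaseFactor s f) z := by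
  have hf' : ContDiffAt ℝ n f z := hf.contDiffAt.restrict_scalars ℝ
  have hre : ContDiffAt ℝ n (fun z ↦ (s * (f z).re : ℝ)) z :=
    contDiffAt_const.mul (Complex.reCLM.contDiff.contDiffAt.comp z hf')
  exact (contDiffAt_const.mul (Complex.ofRealCLM.contDiff.contDiffAt.comp z hre)).cexp

theorem contDiffAt_weight (hs : 0 ≤ s) (hp : AnalyticAt ℂ p z) {n : WithTop ℕ∞} :
    ContDiffAt ℝ n (fun z ↦ (weight s p z : ℂ)) z := by
  have hp' : ContDiffAt ℝ n p z := hp.contDiffAt.restrict_scalars ℝ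
  exact Complex.ofRealCLM.contDiff.contDiffAt.comp z
    ((contDiffAt_const.add (contDiffAt_const.mul (hp'.norm_sq ℝ))).inv (by positivity))

theorem contDiffAt_regInv (hs : 0 ≤ s) (hp : AnalyticAt ℂ p z) {n : WithTop ℕ∞} :
    ContDiffAt ℝ n (regInv s p) z :=
  (contDiffAt_weight hs hp).mul
    (Complex.conjCLE.contDiff.contDiffAt.comp z (hp.contDiffAt.restrict_scalars ℝ))

theorem contDiffAt_ibpCoeff (hs : 0 ≤ s) (hp : AnalyticAt ℂ p z) {n : WithTop ℕ∞} :
    ContDiffAt ℝ n (ibpCoeff s p) z :=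
  (contDiffAt_weight hs hp).sub
    ((contDiffAt_const.mul (hp.deriv.contDiffAt.restrict_scalars ℝ)).mul
      ((contDiffAt_regInv hs hp).pow 2))

theorem contDiff_mul_of_forall_mem_tsupport {v : ℂ → ℂ} {n : WithTop ℕ∞} (hu : ContDiff ℝ n u)
    (hv : ∀ z ∈ tsupport u, ContDiffAt ℝ n v z) : ContDiff ℝ n (fun z ↦ v z * u z) :=
  contMDiff_iff_contDiff.1 <| contMDiff_of_tsupport fun z hz ↦
    ((hv z (tsupport_mul_subset_right hz)).mul hu.contDiffAt).contMDiffAt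

theorem tsupport_ibpAdjoint_subset : tsupport (ibpAdjoint s p u) ⊆ tsupport u := by
  refine closure_minimal (fun z hz ↦ ?_) (isClosed_tsupport u)
  by_contra hzu
  refine hz ?_
  rw [ibpAdjoint, image_eq_zero_of_notMem_tsupport hzu,
    image_eq_zero_of_notMem_tsupport (fun h ↦ hzu (tsupport_wirtingerDeriv_subset h)),
    mul_zero, mul_zero, add_zero]

theorem contDiff_ibpAdjoint (hs : 0 ≤ s) (hp : ∀ z ∈ tsupport u, AnalyticAt ℂ p z)
    {m n : WithTop ℕ∞} (hu : ContDiff ℝ n u) (hmn : m + 1 ≤ n) :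
    ContDiff ℝ m (ibpAdjoint s p u) :=
  (contDiff_mul_of_forall_mem_tsupport (hu.of_le (le_self_add.trans hmn))
    fun z hz ↦ contDiffAt_ibpCoeff hs (hp z hz)).add
  (contDiff_mul_of_forall_mem_tsupport (contDiff_wirtingerDeriv hu hmn)
    fun z hz ↦ contDiffAt_const.mul
      (contDiffAt_regInv hs (hp z (tsupport_wirtingerDeriv_subset hz))))

theorem hasWirtingerDerivAt_phaseFactor_mul_regInv_mul (hs : 0 ≤ s) (hf : HasDerivAt f (p z) z)
    (hp : AnalyticAt ℂ p z) (hu : DifferentiableAt ℝ u z) :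
    HasWirtingerDerivAt (fun z ↦ phaseFactor s f z * regInv s p z * u z)
      (Complex.I / 2 * (phaseFactor s f z * u z - phaseFactor s f z * ibpAdjoint s p u z)) z := by
  convert ((hasWirtingerDerivAt_phaseFactor (s := s) hf).mul
    (hasWirtingerDerivAt_regInv hs hp)).mul (hasWirtingerDerivAt_wirtingerDeriv hu) using 1
  rw [ibpAdjoint, ibpCoeff, weight_eq_one_sub hs]
  linear_combination phaseFactor s f z * (s * deriv p z * regInv s p z ^ 2 * u z
    - regInv s p z * wirtingerDeriv u z) * Complex.I_mul_I

theorem integral_phaseFactor_mul_ibpAdjoint (hs : 0 ≤ s) (hU : IsOpen U)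
    (hf : ∀ z ∈ U, HasDerivAt f (p z) z) (hu : ContDiff ℝ 1 u) (huc : HasCompactSupport u)
    (huU : tsupport u ⊆ U) :
    ∫ z, phaseFactor s f z * ibpAdjoint s p u z = ∫ z, phaseFactor s f z * u z := by
  have hfU : DifferentiableOn ℂ f U :=
    fun z hz ↦ (hf z hz).differentiableAt.differentiableWithinAt
  have hp : ∀ z ∈ tsupport u, AnalyticAt ℂ p z :=
    fun z hz ↦ analyticAt_of_hasDerivAt hU hf (huU hz)
  have hosc : ∀ z ∈ tsupport u, ContDiffAt ℝ 1 (phaseFactor s f) z :=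
    fun z hz ↦ contDiffAt_phaseFactor (hfU.analyticAt (hU.mem_nhds (huU hz)))
  let H : ℂ → ℂ := fun z ↦ phaseFactor s f z * regInv s p z * u z
  have hH : ContDiff ℝ 1 H := contDiff_mul_of_forall_mem_tsupport hu
    fun z hz ↦ (hosc z hz).mul (contDiffAt_regInv hs (hp z hz))
  have hHc : HasCompactSupport H := huc.mul_left
  have hHsupp : tsupport H ⊆ tsupport u := tsupport_mul_subset_right
  have hHderiv : ∀ z, phaseFactor s f z * ibpAdjoint s p u z
      = phaseFactor s f z * u z + 2 * Complex.I * wirtingerDeriv H z := by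
    intro z
    by_cases hz : z ∈ tsupport u
    · rw [(hasWirtingerDerivAt_phaseFactor_mul_regInv_mul hs (hf z (huU hz)) (hp z hz)
        (hu.differentiable one_ne_zero z)).wirtingerDeriv_eq]
      linear_combination (phaseFactor s f z * ibpAdjoint s p u z - phaseFactor s f z * u z)
        * Complex.I_mul_I
    · rw [image_eq_zero_of_notMem_tsupport hz,
        image_eq_zero_of_notMem_tsupport fun h ↦ hz (tsupport_ibpAdjoint_subset h),
        image_eq_zero_of_notMem_tsupport fun h ↦ hz (hHsupp (tsupport_wirtingerDeriv_subset h)),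
        mul_zero, mul_zero, add_zero]
  have hint : Integrable fun z ↦ phaseFactor s f z * u z :=
    (contDiff_mul_of_forall_mem_tsupport hu hosc).continuous.integrable_of_hasCompactSupport
      huc.mul_left
  simp only [hHderiv]
  rw [integral_add hint ((integrable_wirtingerDeriv hH hHc).const_mul _), integral_const_mul,
    integral_wirtingerDeriv_eq_zero hH hHc, mul_zero, add_zero]

theorem integral_phaseFactor_mul_ibpAdjoint_ibpAdjoint (hs : 0 ≤ s) (hU : IsOpen U)
    (hf : ∀ z ∈ U, HasDerivAt f (p z) z) (hu : ContDiff ℝ 2 u) (huc : HasCompactSupport u)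
    (huU : tsupport u ⊆ U) :
    ∫ z, phaseFactor s f z * ibpAdjoint s p (ibpAdjoint s p u) z
      = ∫ z, phaseFactor s f z * u z := by
  rw [integral_phaseFactor_mul_ibpAdjoint hs hU hf _ _ (tsupport_ibpAdjoint_subset.trans huU),
    integral_phaseFactor_mul_ibpAdjoint hs hU hf (hu.of_le one_le_two) huc huU]
  · exact contDiff_ibpAdjoint hs (fun z hz ↦ analyticAt_of_hasDerivAt hU hf (huU hz)) hu
      one_add_one_eq_two.le
  · exact huc.mono' ((subset_tsupport _).trans tsupport_ibpAdjoint_subset)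

end IntegrationByParts

section NormEstimates

variable {s A X : ℝ} {p u : ℂ → ℂ} {z : ℂ}

theorem norm_regInv_sq_le (hs : 0 < s) : ‖regInv s p z‖ ^ 2 ≤ s⁻¹ := by
  rw [← one_div, le_div_iff₀' hs]
  exact (mul_norm_regInv_sq_le_weight hs.le).trans (weight_le_one hs.le)

theorem norm_weight (hs : 0 ≤ s) : ‖(weight s p z : ℂ)‖ = weight s p z := by
  rw [Complex.norm_real, Real.norm_of_nonneg (weight_pos hs).le]

theorem norm_ibpCoeff_le (hs : 0 ≤ s) (hA : 1 ≤ A) (hp : ‖deriv p z‖ ≤ A) :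
    ‖ibpCoeff s p z‖ ≤ 3 * A * weight s p z := by
  have hr := weight_pos (p := p) (z := z) hs
  calc ‖ibpCoeff s p z‖
      ≤ ‖(weight s p z : ℂ)‖ + ‖2 * Complex.I * s * deriv p z * regInv s p z ^ 2‖ := norm_sub_le ..
    _ = weight s p z + 2 * ‖deriv p z‖ * (s * ‖regInv s p z‖ ^ 2) := by
        rw [norm_weight hs]
        simp only [norm_mul, norm_pow, Complex.norm_ofNat, Complex.norm_I, Complex.norm_real,
          Real.norm_of_nonneg hs]
        ring
    _ ≤ A * weight s p z + 2 * A * weight s p z := by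
        gcongr
        · exact le_mul_of_one_le_left hr.le hA
        · exact mul_norm_regInv_sq_le_weight hs
    _ = 3 * A * weight s p z := by ring

theorem norm_ibpAdjoint_le (hs : 0 ≤ s) (hA : 1 ≤ A) (hp : ‖deriv p z‖ ≤ A) :
    ‖ibpAdjoint s p u z‖
      ≤ 3 * A * weight s p z * ‖u z‖ + 2 * (‖regInv s p z‖ * ‖wirtingerDeriv u z‖) := by
  refine (norm_add_le _ _).trans (add_le_add ?_ (le_of_eq ?_))
  · rw [norm_mul]
    gcongr
    exact norm_ibpCoeff_le hs hA hp
  · simp only [norm_mul, Complex.norm_ofNat, Complex.norm_I]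
    ring

theorem norm_regInv_mul_wirtingerDeriv_ibpCoeff_le (hs : 0 ≤ s) (hA : 1 ≤ A)
    (hp : AnalyticAt ℂ p z) (hp' : ‖deriv p z‖ ≤ A) (hp'' : ‖deriv (deriv p) z‖ ≤ A) :
    ‖regInv s p z‖ * ‖wirtingerDeriv (ibpCoeff s p) z‖
      ≤ 5 * A ^ 2 * weight s p z ^ 2 + 2 * A * (weight s p z * ‖regInv s p z‖) := by
  have hr := weight_pos (p := p) (z := z) hs
  have hW := mul_norm_regInv_sq_le_weight (p := p) (z := z) hs
  have hnorm : ‖wirtingerDeriv (ibpCoeff s p) z‖ ≤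
      s * ‖deriv p z‖ * ‖regInv s p z‖ * weight s p z
        + 2 * s * ‖deriv (deriv p) z‖ * ‖regInv s p z‖ ^ 2
        + 4 * s ^ 2 * ‖deriv p z‖ ^ 2 * ‖regInv s p z‖ ^ 3 := by
    rw [(hasWirtingerDerivAt_ibpCoeff hs hp).wirtingerDeriv_eq]
    refine (norm_add_le _ _).trans (add_le_add ((norm_sub_le _ _).trans (le_of_eq ?_))
      (le_of_eq ?_)) <;>
    simp only [norm_mul, norm_neg, norm_pow, Complex.norm_ofNat, Complex.norm_I, Complex.norm_real,
      Real.norm_of_nonneg hs, norm_weight hs, mul_one]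
  calc ‖regInv s p z‖ * ‖wirtingerDeriv (ibpCoeff s p) z‖
      ≤ ‖regInv s p z‖ * (s * ‖deriv p z‖ * ‖regInv s p z‖ * weight s p z
        + 2 * s * ‖deriv (deriv p) z‖ * ‖regInv s p z‖ ^ 2
        + 4 * s ^ 2 * ‖deriv p z‖ ^ 2 * ‖regInv s p z‖ ^ 3) := by gcongr
    _ = ‖deriv p z‖ * (s * ‖regInv s p z‖ ^ 2) * weight s p z
        + 2 * ‖deriv (deriv p) z‖ * ((s * ‖regInv s p z‖ ^ 2) * ‖regInv s p z‖)
        + 4 * ‖deriv p z‖ ^ 2 * (s * ‖regInv s p z‖ ^ 2) ^ 2 := by ring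
    _ ≤ A ^ 2 * weight s p z * weight s p z + 2 * A * (weight s p z * ‖regInv s p z‖)
        + 4 * A ^ 2 * weight s p z ^ 2 := by
        gcongr
        exact hp'.trans (le_self_pow₀ hA two_ne_zero)
    _ = _ := by ring

theorem hasWirtingerDerivAt_ibpAdjoint (hs : 0 ≤ s) (hp : AnalyticAt ℂ p z)
    (hu : ContDiff ℝ 2 u) :
    HasWirtingerDerivAt (ibpAdjoint s p u)
      (wirtingerDeriv (ibpCoeff s p) z * u z + ibpCoeff s p z * wirtingerDeriv u z
        + 2 * Complex.I * (-s * deriv p z * regInv s p z ^ 2 * wirtingerDeriv u z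
          + regInv s p z * wirtingerDeriv (wirtingerDeriv u) z)) z := by
  have hc := hasWirtingerDerivAt_wirtingerDeriv
    ((contDiffAt_ibpCoeff hs hp (n := 1)).differentiableAt one_ne_zero)
  have hu1 := hasWirtingerDerivAt_wirtingerDeriv (hu.differentiable two_ne_zero z)
  have hu2 := hasWirtingerDerivAt_wirtingerDeriv
    ((contDiff_wirtingerDeriv hu one_add_one_eq_two.le).differentiable one_ne_zero z)
  convert (hc.mul hu1).add (((hasWirtingerDerivAt_regInv hs hp).mul hu2).const_mul
    (2 * Complex.I)) using 1
  funext z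
  rw [ibpAdjoint]
  ring

theorem norm_regInv_mul_wirtingerDeriv_ibpAdjoint_le (hs : 0 ≤ s) (hA : 1 ≤ A)
    (hp : AnalyticAt ℂ p z) (hp' : ‖deriv p z‖ ≤ A) (hp'' : ‖deriv (deriv p) z‖ ≤ A)
    (hu : ContDiff ℝ 2 u) (hX : ‖u z‖ ≤ X) (hX' : ‖wirtingerDeriv u z‖ ≤ X)
    (hX'' : ‖wirtingerDeriv (wirtingerDeriv u) z‖ ≤ X) :
    ‖regInv s p z‖ * ‖wirtingerDeriv (ibpAdjoint s p u) z‖ ≤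
      A ^ 2 * X * (5 * weight s p z ^ 2 + 7 * (weight s p z * ‖regInv s p z‖)
        + 2 * ‖regInv s p z‖ ^ 2) := by
  have hX0 : 0 ≤ X := (norm_nonneg _).trans hX
  have hr := weight_pos (p := p) (z := z) hs
  have hA2 : A ≤ A ^ 2 := le_self_pow₀ hA two_ne_zero
  have hnorm : ‖wirtingerDeriv (ibpAdjoint s p u) z‖ ≤
      ‖wirtingerDeriv (ibpCoeff s p) z‖ * ‖u z‖ + ‖ibpCoeff s p z‖ * ‖wirtingerDeriv u z‖
        + 2 * (s * ‖deriv p z‖ * ‖regInv s p z‖ ^ 2 * ‖wirtingerDeriv u z‖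
          + ‖regInv s p z‖ * ‖wirtingerDeriv (wirtingerDeriv u) z‖) := by
    rw [(hasWirtingerDerivAt_ibpAdjoint hs hp hu).wirtingerDeriv_eq]
    refine (norm_add_le _ _).trans (add_le_add ((norm_add_le _ _).trans (le_of_eq ?_)) ?_)
    · simp only [norm_mul]
    · rw [norm_mul, norm_mul, Complex.norm_ofNat, Complex.norm_I, mul_one]
      gcongr
      refine (norm_add_le _ _).trans (le_of_eq ?_)
      simp only [norm_mul, norm_neg, norm_pow, Complex.norm_real, Real.norm_of_nonneg hs]
  set r := weight s p z
  set w := ‖regInv s p z‖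
  calc w * ‖wirtingerDeriv (ibpAdjoint s p u) z‖
      ≤ w * (‖wirtingerDeriv (ibpCoeff s p) z‖ * ‖u z‖ + ‖ibpCoeff s p z‖ * ‖wirtingerDeriv u z‖
        + 2 * (s * ‖deriv p z‖ * w ^ 2 * ‖wirtingerDeriv u z‖
          + w * ‖wirtingerDeriv (wirtingerDeriv u) z‖)) := by gcongr
    _ = w * ‖wirtingerDeriv (ibpCoeff s p) z‖ * ‖u z‖
        + w * ‖ibpCoeff s p z‖ * ‖wirtingerDeriv u z‖
        + 2 * (‖deriv p z‖ * (s * w ^ 2) * w * ‖wirtingerDeriv u z‖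
          + w ^ 2 * ‖wirtingerDeriv (wirtingerDeriv u) z‖) := by ring
    _ ≤ (5 * A ^ 2 * r ^ 2 + 2 * A * (r * w)) * X + w * (3 * A * r) * X
        + 2 * (A * r * w * X + w ^ 2 * X) := by
        gcongr
        · exact norm_regInv_mul_wirtingerDeriv_ibpCoeff_le hs hA hp hp' hp''
        · exact norm_ibpCoeff_le hs hA hp'
        · exact mul_norm_regInv_sq_le_weight hs
    _ = 5 * A ^ 2 * r ^ 2 * X + 7 * A * (r * w) * X + 2 * 1 * w ^ 2 * X := by ring
    _ ≤ 5 * A ^ 2 * r ^ 2 * X + 7 * A ^ 2 * (r * w) * X + 2 * A ^ 2 * w ^ 2 * X := by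
        gcongr
        exact hA.trans hA2
    _ = A ^ 2 * X * (5 * r ^ 2 + 7 * (r * w) + 2 * w ^ 2) := by ring

theorem norm_ibpAdjoint_ibpAdjoint_le (hs : 0 < s) (hA : 1 ≤ A)
    (hp : AnalyticAt ℂ p z) (hp' : ‖deriv p z‖ ≤ A) (hp'' : ‖deriv (deriv p) z‖ ≤ A)
    (hu : ContDiff ℝ 2 u) (hX : ‖u z‖ ≤ X) (hX' : ‖wirtingerDeriv u z‖ ≤ X)
    (hX'' : ‖wirtingerDeriv (wirtingerDeriv u) z‖ ≤ X) :
    ‖ibpAdjoint s p (ibpAdjoint s p u) z‖ ≤ 29 * A ^ 2 * X * (weight s p z ^ 2 + s⁻¹) := by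
  have hX0 : 0 ≤ X := (norm_nonneg _).trans hX
  have hr := weight_pos (p := p) (z := z) hs.le
  have hder := norm_regInv_mul_wirtingerDeriv_ibpAdjoint_le hs.le hA hp hp' hp'' hu hX hX' hX''
  have hw := norm_regInv_sq_le (p := p) (z := z) hs
  have hbase := norm_ibpAdjoint_le (u := u) hs.le hA hp'
  set r := weight s p z
  set w := ‖regInv s p z‖
  calc ‖ibpAdjoint s p (ibpAdjoint s p u) z‖
      ≤ 3 * A * r * ‖ibpAdjoint s p u z‖
        + 2 * (w * ‖wirtingerDeriv (ibpAdjoint s p u) z‖) := norm_ibpAdjoint_le hs.le hA hp'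
    _ ≤ 3 * A * r * (3 * A * r * X + 2 * (w * X))
        + 2 * (A ^ 2 * X * (5 * r ^ 2 + 7 * (r * w) + 2 * w ^ 2)) := by
        gcongr
        refine hbase.trans ?_
        gcongr
    _ = A ^ 2 * X * (19 * r ^ 2 + 14 * (r * w) + 4 * w ^ 2) + A * X * (6 * (r * w)) := by ring
    _ ≤ A ^ 2 * X * (19 * r ^ 2 + 14 * (r * w) + 4 * w ^ 2) + A ^ 2 * X * (6 * (r * w)) := by
        gcongr
        exact le_self_pow₀ hA two_ne_zero
    _ = A ^ 2 * X * (19 * r ^ 2 + 10 * (2 * r * w) + 4 * w ^ 2) := by ring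
    _ ≤ A ^ 2 * X * (19 * r ^ 2 + 10 * (r ^ 2 + w ^ 2) + 4 * w ^ 2) := by
        gcongr
        exact two_mul_le_add_sq r w
    _ = A ^ 2 * X * (29 * r ^ 2 + 14 * w ^ 2) := by ring
    _ ≤ A ^ 2 * X * (29 * r ^ 2 + 29 * s⁻¹) := by
        gcongr
        norm_num
    _ = 29 * A ^ 2 * X * (r ^ 2 + s⁻¹) := by ring

theorem norm_integral_phaseFactor_mul_le {f : ℂ → ℂ} {U : Set ℂ} (hs : 0 < s) (hA : 1 ≤ A)
    (hU : IsOpen U) (hf : ∀ z ∈ U, HasDerivAt f (p z) z) (hu : ContDiff ℝ 2 u)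
    (huc : HasCompactSupport u) (huU : tsupport u ⊆ U)
    (hp' : ∀ z ∈ tsupport u, ‖deriv p z‖ ≤ A) (hp'' : ∀ z ∈ tsupport u, ‖deriv (deriv p) z‖ ≤ A)
    (hX : ∀ z, ‖u z‖ ≤ X) (hX' : ∀ z, ‖wirtingerDeriv u z‖ ≤ X)
    (hX'' : ∀ z, ‖wirtingerDeriv (wirtingerDeriv u) z‖ ≤ X) :
    ‖∫ z, phaseFactor s f z * u z‖
      ≤ 29 * A ^ 2 * X
        * ((∫ z in tsupport u, weight s p z ^ 2) + volume.real (tsupport u) * s⁻¹) := by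
  have hsupp : Function.support (fun z ↦ phaseFactor s f z * ibpAdjoint s p (ibpAdjoint s p u) z)
      ⊆ tsupport u := (Function.support_mul_subset_right _ _).trans <|
    (subset_tsupport _).trans (tsupport_ibpAdjoint_subset.trans tsupport_ibpAdjoint_subset)
  have hp : ∀ z ∈ tsupport u, AnalyticAt ℂ p z :=
    fun z hz ↦ analyticAt_of_hasDerivAt hU hf (huU hz)
  have hcont : ContinuousOn p (tsupport u) :=
    fun z hz ↦ (hp z hz).continuousAt.continuousWithinAt
  have hint : IntegrableOn (fun z ↦ weight s p z ^ 2) (tsupport u) := by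
    unfold weight
    exact ((ContinuousOn.inv₀ (by fun_prop) fun z _ ↦ by positivity).pow 2).integrableOn_compact huc
  have hconst : IntegrableOn (fun _ ↦ s⁻¹) (tsupport u) :=
    continuousOn_const.integrableOn_compact huc
  rw [← smul_eq_mul (volume.real _), ← setIntegral_const, ← integral_add hint hconst,
    ← integral_phaseFactor_mul_ibpAdjoint_ibpAdjoint hs.le hU hf hu huc huU,
    ← setIntegral_eq_integral_of_forall_compl_eq_zero
      fun z hz ↦ Function.notMem_support.1 fun h ↦ hz (hsupp h), ← integral_const_mul]
  refine norm_integral_le_of_norm_le ((hint.add hconst).const_mul _) ?_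
  filter_upwards [ae_restrict_mem (isClosed_tsupport u).measurableSet] with z hz
  rw [norm_mul, norm_phaseFactor, one_mul]
  exact norm_ibpAdjoint_ibpAdjoint_le hs hA (hp z hz) (hp' z hz) (hp'' z hz) hu (hX z) (hX' z)
    (hX'' z)

end NormEstimates

section CriticalPoints

variable {s K R : ℝ} {p χ : ℂ → ℂ} {z a : ℂ}

theorem integrable_weight_one_id_sq : Integrable fun z ↦ weight 1 id z ^ 2 := by
  have hdim : (Module.finrank ℝ ℂ : ℝ) < 4 := by norm_num [Complex.finrank_real_complex]
  refine (integrable_rpow_neg_one_add_norm_sq (μ := volume) hdim).congr (.of_forall fun z ↦ ?_)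
  simp only [weight, id, one_mul]
  rw [show (-4 / 2 : ℝ) = -(2 : ℕ) by norm_num,
    Real.rpow_neg (by positivity), Real.rpow_natCast, inv_pow]

theorem weight_le_weight_one_id (hs : 0 < s) (hK : 0 < K) (h : ‖z - a‖ ≤ K * ‖p z‖) :
    weight s p z ≤ weight 1 id ((√s / K) • (z - a)) := by
  rw [weight, weight, id, one_mul, norm_smul, mul_pow, Real.norm_of_nonneg (by positivity),
    div_pow, Real.sq_sqrt hs.le]
  refine inv_anti₀ (by positivity) (add_le_add_right ?_ 1)
  calc s / K ^ 2 * ‖z - a‖ ^ 2 ≤ s / K ^ 2 * (K * ‖p z‖) ^ 2 := by gcongr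
    _ = s * ‖p z‖ ^ 2 := by field_simp

theorem integral_weight_one_id_smul_sub_sq (hs : 0 < s) (a : ℂ) :
    ∫ z, weight 1 id ((√s / K) • (z - a)) ^ 2 = K ^ 2 * s⁻¹ * ∫ z, weight 1 id z ^ 2 := by
  rw [integral_sub_right_eq_self (fun z ↦ weight 1 id ((√s / K) • z) ^ 2) a,
    Measure.integral_comp_smul volume fun z ↦ weight 1 id z ^ 2,
    Complex.finrank_real_complex, abs_of_nonneg (by positivity), smul_eq_mul, div_pow,
    Real.sq_sqrt hs.le, inv_div, div_eq_mul_inv]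

theorem setIntegral_weight_sq_le {D : Set ℂ} (hD : MeasurableSet D) {S : Finset ℂ} (hs : 0 < s)
    (hK : 0 < K) (h : ∀ z ∈ D, ∃ a ∈ S, ‖z - a‖ ≤ K * ‖p z‖) :
    ∫ z in D, weight s p z ^ 2 ≤ S.card * (K ^ 2 * s⁻¹ * ∫ z, weight 1 id z ^ 2) := by
  have hint (a : ℂ) : Integrable fun z ↦ weight 1 id ((√s / K) • (z - a)) ^ 2 :=
    (integrable_weight_one_id_sq.comp_smul (by positivity)).comp_sub_right a
  have hsum : Integrable fun z ↦ ∑ a ∈ S, weight 1 id ((√s / K) • (z - a)) ^ 2 :=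
    integrable_finsetSum S fun a _ ↦ hint a
  calc ∫ z in D, weight s p z ^ 2
      ≤ ∫ z in D, ∑ a ∈ S, weight 1 id ((√s / K) • (z - a)) ^ 2 := by
        refine integral_mono_of_nonneg (.of_forall fun z ↦ sq_nonneg _) hsum.integrableOn ?_
        filter_upwards [ae_restrict_mem hD] with z hz
        obtain ⟨a, ha, hza⟩ := h z hz
        have hle := weight_le_weight_one_id hs hK hza
        have hpos := weight_pos (p := p) (z := z) hs.le
        calc weight s p z ^ 2 ≤ weight 1 id ((√s / K) • (z - a)) ^ 2 := by gcongr
          _ ≤ _ := Finset.single_le_sum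
            (f := fun a ↦ weight 1 id ((√s / K) • (z - a)) ^ 2) (fun _ _ ↦ sq_nonneg _) ha
    _ ≤ ∫ z, ∑ a ∈ S, weight 1 id ((√s / K) • (z - a)) ^ 2 :=
        setIntegral_le_integral hsum (.of_forall fun z ↦ Finset.sum_nonneg fun _ _ ↦ sq_nonneg _)
    _ = S.card * (K ^ 2 * s⁻¹ * ∫ z, weight 1 id z ^ 2) := by
        rw [integral_finsetSum S fun a _ ↦ hint a]
        simp only [integral_weight_one_id_smul_sub_sq hs, Finset.sum_const, nsmul_eq_mul]

theorem exists_norm_sub_le_mul_norm_inv_sub (hR : 0 < R) (v : ℂ) :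
    ∃ a, ∀ z ≠ 0, ‖z‖ ≤ R → ‖z - a‖ ≤ 2 * R ^ 2 * ‖z⁻¹ - v‖ := by
  rcases le_or_gt (2 * R)⁻¹ ‖v‖ with hv | hv
  · have hv0 : v ≠ 0 := norm_pos_iff.1 (lt_of_lt_of_le (by positivity) hv)
    refine ⟨v⁻¹, fun z hz hzR ↦ ?_⟩
    have hvinv : ‖v‖⁻¹ ≤ 2 * R := inv_le_of_inv_le₀ (by positivity) hv
    calc ‖z - v⁻¹‖ = ‖z‖ * ‖v‖⁻¹ * ‖z⁻¹ - v‖ := by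
          rw [← norm_inv, ← norm_mul, ← norm_mul, norm_sub_rev]
          congr 1
          field_simp
      _ ≤ R * (2 * R) * ‖z⁻¹ - v‖ := by gcongr
      _ = 2 * R ^ 2 * ‖z⁻¹ - v‖ := by ring
  · refine ⟨0, fun z hz hzR ↦ ?_⟩
    have hfar : (2 * R)⁻¹ ≤ ‖z⁻¹ - v‖ := by
      have hinv : R⁻¹ ≤ ‖z⁻¹‖ := by
        rw [norm_inv]
        exact inv_anti₀ (norm_pos_iff.2 hz) hzR
      calc (2 * R)⁻¹ = R⁻¹ - (2 * R)⁻¹ := by field_simp; norm_num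
        _ ≤ ‖z⁻¹‖ - ‖v‖ := by gcongr
        _ ≤ ‖z⁻¹ - v‖ := norm_sub_norm_le _ _
    calc ‖z - 0‖ ≤ R := by rwa [sub_zero]
      _ = 2 * R ^ 2 * (2 * R)⁻¹ := by field_simp
      _ ≤ 2 * R ^ 2 * ‖z⁻¹ - v‖ := by gcongr

theorem exists_finset_norm_sub_le (hR : 0 < R) (w : ℂ) :
    ∃ S : Finset ℂ, S.card ≤ 2 ∧ ∀ z ≠ 0, ‖z‖ ≤ R →
      ∃ a ∈ S, ‖z - a‖ ≤ 2 * R ^ 3 * ‖w + z ^ (-2 : ℤ)‖ := by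
  obtain ⟨v, hv⟩ := IsAlgClosed.exists_pow_nat_eq (-w) two_pos
  obtain ⟨a, ha⟩ := exists_norm_sub_le_mul_norm_inv_sub hR v
  obtain ⟨b, hb⟩ := exists_norm_sub_le_mul_norm_inv_sub hR (-v)
  refine ⟨{a, b}, Finset.card_le_two, fun z hz hzR ↦ ?_⟩
  have hprod : ‖w + z ^ (-2 : ℤ)‖ = ‖z⁻¹ - v‖ * ‖z⁻¹ - -v‖ := by
    rw [← norm_mul, zpow_neg, zpow_ofNat]
    congr 1
    linear_combination hv
  have hinv : 1 ≤ R * ‖z⁻¹‖ := by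
    rw [norm_inv, ← div_eq_mul_inv, one_le_div (norm_pos_iff.2 hz)]
    exact hzR
  have hsum : 2 * ‖z⁻¹‖ ≤ ‖z⁻¹ - v‖ + ‖z⁻¹ - -v‖ := by
    calc 2 * ‖z⁻¹‖ = ‖(z⁻¹ - v) + (z⁻¹ - -v)‖ := by
          rw [← Complex.norm_two, ← norm_mul]
          ring_nf
      _ ≤ _ := norm_add_le _ _
  have hfactor {x y : ℝ} (hx : 0 ≤ x) (hxy : x ≤ y) (hxy' : 2 * ‖z⁻¹‖ ≤ x + y) :
      2 * R ^ 2 * x ≤ 2 * R ^ 3 * (x * y) := by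
    have hy : 1 ≤ R * y := hinv.trans (by gcongr; linarith)
    calc 2 * R ^ 2 * x ≤ 2 * R ^ 2 * x * (R * y) := le_mul_of_one_le_right (by positivity) hy
      _ = 2 * R ^ 3 * (x * y) := by ring
  rw [hprod]
  rcases le_total ‖z⁻¹ - v‖ ‖z⁻¹ - -v‖ with h | h
  · exact ⟨a, by simp, (ha z hz hzR).trans (hfactor (norm_nonneg _) h hsum)⟩
  · refine ⟨b, by simp, (hb z hz hzR).trans ?_⟩
    rw [mul_comm ‖z⁻¹ - v‖]
    exact hfactor (norm_nonneg _) h (by linarith)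

theorem hasDerivAt_mul_sub_inv (w : ℂ) (hz : z ≠ 0) :
    HasDerivAt (fun z ↦ w * z - z⁻¹) (w + z ^ (-2 : ℤ)) z := by
  refine (((hasDerivAt_id z).const_mul w).sub (hasDerivAt_inv hz)).congr_deriv ?_
  rw [mul_one, sub_neg_eq_add, zpow_neg, zpow_ofNat]

theorem exists_norm_deriv_add_zpow_le {D : Set ℂ} (hD : IsCompact D) (h0 : (0 : ℂ) ∉ D) :
    ∃ A, 1 ≤ A ∧ ∀ w, ∀ z ∈ D, ‖deriv (fun z ↦ w + z ^ (-2 : ℤ)) z‖ ≤ A ∧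
      ‖deriv (deriv fun z ↦ w + z ^ (-2 : ℤ)) z‖ ≤ A := by
  have hq : ∀ z ∈ D, AnalyticAt ℂ (fun z ↦ z ^ (-2 : ℤ)) z :=
    fun z hz ↦ analyticAt_id.zpow (ne_of_mem_of_not_mem hz h0)
  obtain ⟨A, hA⟩ := hD.exists_bound_of_continuousOn
    fun z hz ↦ (hq z hz).deriv.continuousAt.continuousWithinAt
  obtain ⟨B, hB⟩ := hD.exists_bound_of_continuousOn
    fun z hz ↦ (hq z hz).deriv.deriv.continuousAt.continuousWithinAt
  refine ⟨max 1 (max A B), le_max_left _ _, fun w z hz ↦ ?_⟩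
  simp only [deriv_const_add']
  exact ⟨(hA z hz).trans (by simp), (hB z hz).trans (by simp)⟩

theorem exists_norm_wirtingerDeriv_le (hχ : ContDiff ℝ 2 χ) (hc : HasCompactSupport χ) :
    ∃ X, ∀ z, ‖χ z‖ ≤ X ∧ ‖wirtingerDeriv χ z‖ ≤ X ∧
      ‖wirtingerDeriv (wirtingerDeriv χ) z‖ ≤ X := by
  have hχ1 : ContDiff ℝ 1 (wirtingerDeriv χ) := contDiff_wirtingerDeriv hχ one_add_one_eq_two.le
  have hχ2 : ContDiff ℝ 0 (wirtingerDeriv (wirtingerDeriv χ)) :=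
    contDiff_wirtingerDeriv hχ1 (zero_add 1).le
  have hc1 : HasCompactSupport (wirtingerDeriv χ) :=
    hc.mono' ((subset_tsupport _).trans tsupport_wirtingerDeriv_subset)
  have hc2 : HasCompactSupport (wirtingerDeriv (wirtingerDeriv χ)) :=
    hc1.mono' ((subset_tsupport _).trans tsupport_wirtingerDeriv_subset)
  obtain ⟨A, hA⟩ := hc.exists_bound_of_continuous hχ.continuous
  obtain ⟨B, hB⟩ := hc1.exists_bound_of_continuous hχ1.continuous
  obtain ⟨C, hC⟩ := hc2.exists_bound_of_continuous hχ2.continuous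
  exact ⟨max A (max B C), fun z ↦ ⟨(hA z).trans (by simp), (hB z).trans (by simp),
    (hC z).trans (by simp)⟩⟩

theorem exists_norm_integral_phaseFactor_mul_sub_inv_le (hχ : ContDiff ℝ 2 χ)
    (hc : HasCompactSupport χ) (h0 : (0 : ℂ) ∉ tsupport χ) :
    ∃ C, 0 < C ∧ ∀ s, 0 < s → ∀ w : ℂ,
      ‖∫ z, phaseFactor s (fun z ↦ w * z - z⁻¹) z * χ z‖ ≤ C * s⁻¹ := by
  obtain ⟨A, hA, hderiv⟩ := exists_norm_deriv_add_zpow_le hc h0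
  obtain ⟨X, hX⟩ := exists_norm_wirtingerDeriv_le hχ hc
  obtain ⟨R, hR, hRball⟩ := hc.isBounded.exists_pos_norm_le
  have hX0 : 0 ≤ X := (norm_nonneg _).trans (hX 0).1
  have hne : ∀ z ∈ tsupport χ, z ≠ 0 := fun z hz ↦ ne_of_mem_of_not_mem hz h0
  refine ⟨29 * A ^ 2 * X * (2 * ((2 * R ^ 3) ^ 2 * ∫ z, weight 1 id z ^ 2)
    + volume.real (tsupport χ)) + 1, by positivity, fun s hs w ↦ ?_⟩
  obtain ⟨S, hS, hcrit⟩ := exists_finset_norm_sub_le hR w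
  set p : ℂ → ℂ := fun z ↦ w + z ^ (-2 : ℤ)
  have hweight : ∫ z in tsupport χ, weight s p z ^ 2
      ≤ 2 * ((2 * R ^ 3) ^ 2 * s⁻¹ * ∫ z, weight 1 id z ^ 2) := by
    refine (setIntegral_weight_sq_le (isClosed_tsupport χ).measurableSet hs (by positivity)
      fun z hz ↦ hcrit z (hne z hz) (hRball z hz)).trans ?_
    gcongr
    exact_mod_cast hS
  calc _ ≤ 29 * A ^ 2 * X
        * ((∫ z in tsupport χ, weight s p z ^ 2) + volume.real (tsupport χ) * s⁻¹) :=
        norm_integral_phaseFactor_mul_le hs hA isOpen_compl_singleton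
          (fun z hz ↦ hasDerivAt_mul_sub_inv w hz) hχ hc hne
          (fun z hz ↦ (hderiv w z hz).1) (fun z hz ↦ (hderiv w z hz).2)
          (fun z ↦ (hX z).1) (fun z ↦ (hX z).2.1) fun z ↦ (hX z).2.2
    _ ≤ 29 * A ^ 2 * X * (2 * ((2 * R ^ 3) ^ 2 * s⁻¹ * ∫ z, weight 1 id z ^ 2)
        + volume.real (tsupport χ) * s⁻¹) := by gcongr
    _ ≤ _ := by linarith [inv_pos.2 hs]

end CriticalPoints

section Plane

/-- The isometric identification of the Euclidean plane with `ℂ`, through which phase functions on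
the plane are differentiated as functions of a complex variable. -/
noncomputable def toComplex : Plane ≃ₗᵢ[ℝ] ℂ := Complex.orthonormalBasisOneI.repr.symm

/-- The multiplier `e^{i x·ξ - i t ξ₁ / |ξ|²}` of the translated semigroup, so that
`semigroup t g x` is the integral of `wave t x` against `fourierHat g`. -/
noncomputable def wave (t : ℝ) (x ξ : Plane) : ℂ :=
  Complex.exp (Complex.I * ((inner ℝ x ξ : ℝ) : ℂ)
    - Complex.I * ((t * (ξ 0 / ‖ξ‖ ^ 2) : ℝ) : ℂ))

theorem toComplex_apply (ξ : Plane) : toComplex ξ = ξ 0 + ξ 1 * Complex.I :=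
  Complex.orthonormalBasisOneI_repr_symm_apply ξ

theorem inner_eq_re (x ξ : Plane) : inner ℝ x ξ = (conj (toComplex x) * toComplex ξ).re := by
  rw [← toComplex.inner_map_map x ξ, Complex.inner, mul_comm]

theorem apply_zero_div_norm_sq (ξ : Plane) : ξ 0 / ‖ξ‖ ^ 2 = ((toComplex ξ)⁻¹).re := by
  rw [Complex.inv_re, Complex.normSq_eq_norm_sq, toComplex.norm_map, toComplex_apply]
  simp

theorem wave_eq_phaseFactor {t R : ℝ} (ht : 0 < t) (hR : 0 < R) (x ξ : Plane) :
    wave t x ξ = phaseFactor (t * R) (fun z ↦ conj (toComplex x) / (t * R ^ 2 : ℝ) * z - z⁻¹)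
      (toComplex (R • ξ)) := by
  have hR' : (R : ℂ) ≠ 0 := by exact_mod_cast hR.ne'
  have ht' : (t : ℂ) ≠ 0 := by exact_mod_cast ht.ne'
  rw [wave, phaseFactor, ← mul_sub, ← Complex.ofReal_sub, inner_eq_re, apply_zero_div_norm_sq,
    ← Complex.re_ofReal_mul, ← Complex.re_ofReal_mul, ← Complex.sub_re, map_smul,
    Complex.real_smul, mul_inv]
  congr 4
  push_cast
  field_simp

theorem norm_wave (t : ℝ) (x ξ : Plane) : ‖wave t x ξ‖ = 1 := by
  rw [wave, ← mul_sub, ← Complex.ofReal_sub, Complex.norm_exp_I_mul_ofReal]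

theorem measurable_wave (t : ℝ) (x : Plane) : Measurable (wave t x) := by
  unfold wave
  fun_prop

theorem exp_mul_wave (t : ℝ) (x y ξ : Plane) :
    Complex.exp (-Complex.I * ((inner ℝ ξ y : ℝ) : ℂ)) * wave t x ξ = wave t (x - y) ξ := by
  rw [wave, wave, ← Complex.exp_add, inner_sub_left, real_inner_comm]
  congr 1
  push_cast
  ring

theorem integrable_wave_mul {t : ℝ} {x : Plane} {m : Plane → ℂ} (hm : Integrable m) :
    Integrable fun ξ ↦ wave t x ξ * m ξ :=
  hm.bdd_mul (c := 1) (measurable_wave t x).aestronglyMeasurable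
    (.of_forall fun ξ ↦ (norm_wave t x ξ).le)

theorem fourierHat_wave_mul (t : ℝ) (x y : Plane) (m : Plane → ℂ) :
    fourierHat (fun ξ ↦ wave t x ξ * m ξ) y
      = ((2 * Real.pi) ^ 2 : ℂ)⁻¹ * ∫ ξ, wave t (x - y) ξ * m ξ := by
  simp only [fourierHat, ← mul_assoc, exp_mul_wave]

theorem exists_norm_integral_wave_mul_le {χ : ℂ → ℂ} (hχ : ContDiff ℝ 2 χ)
    (hc : HasCompactSupport χ) (h0 : (0 : ℂ) ∉ tsupport χ) :
    ∃ C, 0 < C ∧ ∀ t, 0 < t → ∀ R, 0 < R → ∀ x,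
      ‖∫ ξ, wave t x ξ * χ (toComplex (R • ξ))‖ ≤ C * t⁻¹ * R⁻¹ ^ 3 := by
  obtain ⟨C, hC, hbound⟩ := exists_norm_integral_phaseFactor_mul_sub_inv_le hχ hc h0
  refine ⟨C, hC, fun t ht R hR x ↦ ?_⟩
  set w : ℂ := conj (toComplex x) / (t * R ^ 2 : ℝ)
  set F : ℂ → ℂ := fun z ↦ phaseFactor (t * R) (fun z ↦ w * z - z⁻¹) z * χ z
  calc ‖∫ ξ, wave t x ξ * χ (toComplex (R • ξ))‖
      = ‖∫ ξ, F (toComplex (R • ξ))‖ := by simp only [wave_eq_phaseFactor ht hR, F, w]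
    _ = (R ^ 2)⁻¹ * ‖∫ ξ, F (toComplex ξ)‖ := by
        rw [Measure.integral_comp_smul_of_nonneg volume (fun ξ ↦ F (toComplex ξ)) R (hR := hR.le),
          finrank_euclideanSpace_fin, norm_smul, Real.norm_of_nonneg (by positivity)]
    _ = (R ^ 2)⁻¹ * ‖∫ z, F z‖ := by
        rw [toComplex.measurePreserving.integral_comp
          toComplex.toHomeomorph.measurableEmbedding]
    _ ≤ (R ^ 2)⁻¹ * (C * (t * R)⁻¹) := by
        gcongr
        exact hbound _ (by positivity) w
    _ = C * t⁻¹ * R⁻¹ ^ 3 := by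
        rw [mul_inv]
        ring

end Plane

section Fourier

open FourierTransform Real

variable {g m h : Plane → ℂ}

theorem fourierHat_eq (g : Plane → ℂ) (ξ : Plane) :
    fourierHat g ξ = ((2 * π) ^ 2 : ℂ)⁻¹ * 𝓕 g ((2 * π)⁻¹ • ξ) := by
  rw [fourierHat, Real.fourier_eq']
  congr! 5
  simp only [inner_smul_right]
  push_cast
  field_simp

theorem fourierInv_eq (h : Plane → ℂ) (x : Plane) : fourierInv h x = 𝓕⁻ h ((2 * π)⁻¹ • x) := by
  rw [fourierInv, Real.fourierInv_eq']
  congr! 4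
  simp only [inner_smul_right, real_inner_comm]
  push_cast
  field_simp

theorem continuous_fourierHat (hg : Integrable g) : Continuous (fourierHat g) := by
  have : Continuous (𝓕 g) := VectorFourier.fourierIntegral_continuous Real.continuous_fourierChar
    (by exact continuous_inner) hg
  rw [funext (fourierHat_eq g)]
  fun_prop

theorem continuous_fourierInv (hh : Integrable h) : Continuous (fourierInv h) := by
  have : Continuous (𝓕⁻ h) := by
    rw [Real.fourierInv_eq_fourier_comp_neg]
    exact VectorFourier.fourierIntegral_continuous Real.continuous_fourierChar
      (by exact continuous_inner) hh.comp_neg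
  rw [funext (fourierInv_eq h)]
  fun_prop

theorem integrable_fourierHat (hg : ContDiff ℝ ∞ g) (hc : HasCompactSupport g) :
    Integrable (fourierHat g) := by
  have : Integrable (𝓕 g) := by
    have := (𝓕 (hc.toSchwartzMap hg)).integrable (μ := volume)
    rwa [SchwartzMap.fourier_coe] at this
  rw [funext (fourierHat_eq g)]
  exact (this.comp_smul (by positivity)).const_mul _

theorem integral_fourierHat_mul_fourierInv (hm : Integrable m) (hc : Continuous h)
    (hh : Integrable h) (hinv : Integrable (fourierInv h)) :
    ∫ y, fourierHat m y * fourierInv h y = ∫ ξ, m ξ * h ξ := by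
  have hinv' : Integrable (𝓕⁻ h) := by
    rw [funext (fourierInv_eq h)] at hinv
    exact (integrable_comp_smul_iff volume _ (by positivity)).1 hinv
  have hfourier : Integrable (𝓕 h) := by
    simpa only [Real.fourierInv_eq_fourier_neg, neg_neg] using hinv'.comp_neg
  have hflip : ∫ ξ, 𝓕 m ξ * 𝓕⁻ h ξ = ∫ ξ, m ξ * 𝓕 (𝓕⁻ h) ξ := by
    have := VectorFourier.integral_fourierIntegral_smul_eq_flip (μ := (volume : Measure Plane))
      (ν := (volume : Measure Plane)) (L := innerₗ Plane) Real.continuous_fourierChar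
      (by exact continuous_inner) hm hinv'
    rwa [flip_innerₗ] at this
  have hpi : (π : ℂ) ≠ 0 := by exact_mod_cast pi_ne_zero
  calc ∫ y, fourierHat m y * fourierInv h y
      = ((2 * π) ^ 2 : ℂ)⁻¹ * ∫ y, 𝓕 m ((2 * π)⁻¹ • y) * 𝓕⁻ h ((2 * π)⁻¹ • y) := by
        simp only [fourierHat_eq, fourierInv_eq, mul_assoc, integral_const_mul]
    _ = ∫ ξ, 𝓕 m ξ * 𝓕⁻ h ξ := by
        rw [Measure.integral_comp_inv_smul_of_nonneg volume (fun y ↦ 𝓕 m y * 𝓕⁻ h y)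
          two_pi_pos.le, finrank_euclideanSpace_fin, Complex.real_smul]
        push_cast
        rw [inv_mul_cancel_left₀ (pow_ne_zero 2 (mul_ne_zero two_ne_zero hpi))]
    _ = ∫ ξ, m ξ * h ξ := by rw [hflip, hc.fourier_fourierInv_eq hh hfourier]

theorem enorm_integral_mul_le {B : ℝ} (hB : 0 < B) (hm : Integrable m)
    (hmB : ∀ y, ‖fourierHat m y‖ ≤ B) (hc : Continuous h) (hh : Integrable h) :
    ‖∫ ξ, m ξ * h ξ‖ₑ ≤ ENNReal.ofReal B * eLpNorm (fourierInv h) 1 volume := by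
  by_cases htop : eLpNorm (fourierInv h) 1 volume = ⊤
  · rw [htop, ENNReal.mul_top (ENNReal.ofReal_pos.2 hB).ne']
    exact le_top
  have hinv : Integrable (fourierInv h) := memLp_one_iff_integrable.1
    ⟨(continuous_fourierInv hh).aestronglyMeasurable, lt_top_iff_ne_top.2 htop⟩
  rw [← integral_fourierHat_mul_fourierInv hm hc hh hinv, eLpNorm_one_eq_lintegral_enorm,
    ← lintegral_const_mul' _ _ ENNReal.ofReal_ne_top]
  refine (enorm_integral_le_lintegral_enorm _).trans (lintegral_mono fun y ↦ ?_)
  rw [enorm_mul, ← ofReal_norm (fourierHat m y)]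
  gcongr
  exact hmB y

end Fourier

section Dispersion

theorem exists_contDiff_eq_one_of_isCompact {E : Type*} [NormedAddCommGroup E] [NormedSpace ℝ E]
    [FiniteDimensional ℝ E] {K U : Set E} (hK : IsCompact K) (hU : IsOpen U) (hKU : K ⊆ U) :
    ∃ f : E → ℝ, ContDiff ℝ ∞ f ∧ HasCompactSupport f ∧ tsupport f ⊆ U ∧ ∀ x ∈ K, f x = 1 := by
  obtain ⟨L, hL, hKL, hLU⟩ := exists_compact_between hK hU hKU
  obtain ⟨f, hf_one, hf_zero, -⟩ := exists_contMDiffMap_one_nhds_of_subset_interior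
    (n := ⊤) (modelWithCornersSelf ℝ E) hK.isClosed hKL
  have hsupp : tsupport f ⊆ L := closure_minimal
    (fun x hx ↦ by_contra fun hxL ↦ hx (hf_zero x hxL)) hL.isClosed
  exact ⟨f, f.contMDiff.contDiff, hL.of_isClosed_subset (isClosed_tsupport _) hsupp,
    hsupp.trans hLU, fun x hx ↦ (hf_one.filter_mono (nhds_le_nhdsSet hx)).self_of_nhds⟩

theorem exists_enorm_integral_wave_mul_le :
    ∃ C, 0 < C ∧ ∀ t, 0 < t → ∀ R, 0 < R → ∀ h : Plane → ℂ, Continuous h → Integrable h →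
      Function.support h ⊆ {ξ | 1 / 2 ≤ ‖R • ξ‖ ∧ ‖R • ξ‖ ≤ 2} → ∀ x,
        ‖∫ ξ, wave t x ξ * h ξ‖ₑ
          ≤ ENNReal.ofReal (C * t⁻¹ * R⁻¹ ^ 3) * eLpNorm (fourierInv h) 1 volume := by
  have hshell : IsCompact {z : ℂ | 1 / 2 ≤ ‖z‖ ∧ ‖z‖ ≤ 2} :=
    (isCompact_closedBall 0 2).of_isClosed_subset
      ((isClosed_le continuous_const continuous_norm).inter
        (isClosed_le continuous_norm continuous_const)) fun z hz ↦ mem_closedBall_zero_iff.2 hz.2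
  obtain ⟨f, hf, hfc, hf0, hf1⟩ := exists_contDiff_eq_one_of_isCompact hshell
    (isOpen_compl_singleton (x := 0)) (by rintro _ ⟨hz, -⟩ rfl; norm_num at hz)
  set χ : ℂ → ℂ := fun z ↦ f z
  have hχ : ContDiff ℝ 2 χ := Complex.ofRealCLM.contDiff.comp (contDiff_infty.1 hf 2)
  have hχc : HasCompactSupport χ := hfc.comp_left Complex.ofReal_zero
  have hχ0 : (0 : ℂ) ∉ tsupport χ := fun h0 ↦
    hf0 (tsupport_comp_subset Complex.ofReal_zero f h0) rfl
  obtain ⟨C, hC, hkernel⟩ := exists_norm_integral_wave_mul_le hχ hχc hχ0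
  refine ⟨C, hC, fun t ht R hR h hh hhi hsupp x ↦ ?_⟩
  have hχi : Integrable fun ξ ↦ χ (toComplex (R • ξ)) :=
    (toComplex.measurePreserving.integrable_comp_of_integrable
      (hχ.continuous.integrable_of_hasCompactSupport hχc)).comp_smul hR.ne'
  have hcutoff : ∀ ξ, wave t x ξ * h ξ = wave t x ξ * χ (toComplex (R • ξ)) * h ξ := by
    intro ξ
    by_cases hξ : h ξ = 0
    · simp only [hξ, mul_zero]
    · have : χ (toComplex (R • ξ)) = 1 := by
        rw [← Complex.ofReal_one, ← hf1 (toComplex (R • ξ)) (by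
          simpa only [mem_ofPred_eq, toComplex.norm_map] using hsupp hξ)]
      rw [this, mul_one]
  simp only [hcutoff]
  refine enorm_integral_mul_le (by positivity) (integrable_wave_mul hχi) (fun y ↦ ?_) hh hhi
  rw [fourierHat_wave_mul, norm_mul]
  refine (mul_le_of_le_one_left (norm_nonneg _) ?_).trans (hkernel t ht R hR (x - y))
  have : (1 : ℝ) ≤ (2 * Real.pi) ^ 2 := one_le_pow₀ (by linarith [Real.pi_gt_three])
  rw [norm_inv, norm_pow, norm_mul, Complex.norm_real, Real.norm_of_nonneg Real.pi_pos.le]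
  simpa using inv_le_one_of_one_le₀ this

end Dispersion

section LittlewoodPaley

variable {φ : Plane → ℝ} {g : Plane → ℂ}

theorem mem_Icc_log_of_norm_zpow_smul {E : Type*} [NormedAddCommGroup E] [NormedSpace ℝ E] {ξ : E}
    (hξ : ξ ≠ 0) {j : ℤ} (h1 : 1 / 2 ≤ ‖(2 : ℝ) ^ (-j) • ξ‖) (h2 : ‖(2 : ℝ) ^ (-j) • ξ‖ ≤ 2) :
    j ∈ Finset.Icc (Int.log 2 ‖ξ‖ - 1) (Int.log 2 ‖ξ‖ + 1) := by
  have hlog_le : (2 : ℝ) ^ Int.log 2 ‖ξ‖ ≤ ‖ξ‖ :=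
    mod_cast Int.zpow_log_le_self one_lt_two (norm_pos_iff.2 hξ)
  have hlt_log : ‖ξ‖ < (2 : ℝ) ^ (Int.log 2 ‖ξ‖ + 1) :=
    mod_cast Int.lt_zpow_succ_log_self one_lt_two ‖ξ‖
  have hj : (0 : ℝ) < 2 ^ j := by positivity
  rw [norm_smul, Real.norm_of_nonneg (by positivity), zpow_neg, inv_mul_eq_div] at h1 h2
  rw [le_div_iff₀ hj] at h1
  rw [div_le_iff₀ hj] at h2
  have hlower : (2 : ℝ) ^ (j - 1) < 2 ^ (Int.log 2 ‖ξ‖ + 1) := by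
    rw [zpow_sub_one₀ two_ne_zero]
    linarith
  have hupper : (2 : ℝ) ^ Int.log 2 ‖ξ‖ ≤ 2 ^ (j + 1) := by
    rw [zpow_add_one₀ two_ne_zero]
    linarith
  rw [zpow_lt_zpow_iff_right₀ one_lt_two] at hlower
  rw [zpow_le_zpow_iff_right₀ one_lt_two] at hupper
  rw [Finset.mem_Icc]
  lia

theorem hasCompactSupport_of_support_subset_shell
    (hsupp : Function.support φ ⊆ {ξ | 1 / 2 ≤ ‖ξ‖ ∧ ‖ξ‖ ≤ 2}) : HasCompactSupport φ :=
  HasCompactSupport.of_support_subset_isCompact (isCompact_closedBall 0 2)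
    fun _ hξ ↦ mem_closedBall_zero_iff.2 (hsupp hξ).2

theorem exists_tsum_enorm_dilate_le (hφ : Continuous φ)
    (hsupp : Function.support φ ⊆ {ξ | 1 / 2 ≤ ‖ξ‖ ∧ ‖ξ‖ ≤ 2}) :
    ∃ M : ℝ≥0∞, M ≠ ⊤ ∧ ∀ ξ, ξ ≠ 0 → ∑' j : ℤ, ‖(φ ((2 : ℝ) ^ (-j) • ξ) : ℂ)‖ₑ ≤ M := by
  obtain ⟨A, hA⟩ :=
    (hasCompactSupport_of_support_subset_shell hsupp).exists_bound_of_continuous hφ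
  refine ⟨3 * ENNReal.ofReal A, by finiteness, fun ξ hξ ↦ ?_⟩
  set n := Int.log 2 ‖ξ‖
  have hcard : (Finset.Icc (n - 1) (n + 1)).card = 3 := by
    rw [Int.card_Icc]
    lia
  have hzero : ∀ j ∉ Finset.Icc (n - 1) (n + 1), ‖(φ ((2 : ℝ) ^ (-j) • ξ) : ℂ)‖ₑ = 0 := by
    intro j hj
    rw [enorm_eq_zero, Complex.ofReal_eq_zero]
    by_contra hne
    obtain ⟨h1, h2⟩ := hsupp hne
    exact hj (mem_Icc_log_of_norm_zpow_smul hξ h1 h2)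
  calc _ = ∑ j ∈ Finset.Icc (n - 1) (n + 1), ‖(φ ((2 : ℝ) ^ (-j) • ξ) : ℂ)‖ₑ := tsum_eq_sum hzero
    _ ≤ (Finset.Icc (n - 1) (n + 1)).card • ENNReal.ofReal A := by
        refine Finset.sum_le_card_nsmul _ _ _ fun j _ ↦ ?_
        rw [← ofReal_norm, Complex.norm_real]
        exact ENNReal.ofReal_le_ofReal (hA _)
    _ = 3 * ENNReal.ofReal A := by rw [hcard, nsmul_eq_mul, Nat.cast_ofNat]

theorem exists_enorm_integral_wave_mul_dilate_le :
    ∃ C, 0 < C ∧ ∀ t, 0 < t → ∀ φ : Plane → ℝ, Continuous φ →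
      Function.support φ ⊆ {ξ | 1 / 2 ≤ ‖ξ‖ ∧ ‖ξ‖ ≤ 2} → ∀ g, Integrable g → ∀ x, ∀ j : ℤ,
        ‖∫ ξ, wave t x ξ * (φ ((2 : ℝ) ^ (-j) • ξ) * fourierHat g ξ)‖ₑ
          ≤ ENNReal.ofReal (C * t⁻¹ * ((2 : ℝ) ^ j) ^ 3) * eLpNorm (lpProj φ j g) 1 volume := by
  obtain ⟨C, hC, hdispersive⟩ := exists_enorm_integral_wave_mul_le
  refine ⟨C, hC, fun t ht φ hφ hsupp g hg x j ↦ ?_⟩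
  have hcont : Continuous fun ξ ↦ (φ ((2 : ℝ) ^ (-j) • ξ) : ℂ) * fourierHat g ξ := by
    have := continuous_fourierHat hg
    fun_prop
  have hcompact : HasCompactSupport fun ξ ↦ (φ ((2 : ℝ) ^ (-j) • ξ) : ℂ) :=
    ((hasCompactSupport_of_support_subset_shell hsupp).comp_smul
      (c := (2 : ℝ) ^ (-j)) (by positivity)).comp_left Complex.ofReal_zero
  have hpiece := hdispersive t ht ((2 : ℝ) ^ (-j)) (by positivity) _ hcont
    (hcont.integrable_of_hasCompactSupport hcompact.mul_right)
    (fun ξ hξ ↦ hsupp (Complex.ofReal_ne_zero.1 (left_ne_zero_of_mul hξ))) x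
  rw [← zpow_neg, neg_neg] at hpiece
  exact hpiece

theorem semigroup_eq_tsum (hφ : Continuous φ)
    (hsupp : Function.support φ ⊆ {ξ | 1 / 2 ≤ ‖ξ‖ ∧ ‖ξ‖ ≤ 2})
    (hsum : ∀ ξ, ξ ≠ 0 → HasSum (fun j : ℤ ↦ φ ((2 : ℝ) ^ (-j) • ξ)) 1)
    (hg : Integrable (fourierHat g)) (t : ℝ) (x : Plane) :
    semigroup t g x
      = ∑' j : ℤ, ∫ ξ, wave t x ξ * (φ ((2 : ℝ) ^ (-j) • ξ) * fourierHat g ξ) := by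
  obtain ⟨M, hM, hle⟩ := exists_tsum_enorm_dilate_le hφ hsupp
  have hwave : Integrable fun ξ ↦ wave t x ξ * fourierHat g ξ := integrable_wave_mul hg
  have hmeas : ∀ j : ℤ, AEStronglyMeasurable
      (fun ξ ↦ wave t x ξ * (φ ((2 : ℝ) ^ (-j) • ξ) * fourierHat g ξ)) volume := fun j ↦
    (measurable_wave t x).aestronglyMeasurable.mul
      ((by fun_prop : Continuous fun ξ : Plane ↦
        (φ ((2 : ℝ) ^ (-j) • ξ) : ℂ)).aestronglyMeasurable.mul hg.aestronglyMeasurable)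
  have hfinite : ∑' j : ℤ, ∫⁻ ξ, ‖wave t x ξ * (φ ((2 : ℝ) ^ (-j) • ξ) * fourierHat g ξ)‖ₑ ≠ ⊤ := by
    rw [← lintegral_tsum fun j ↦ (hmeas j).enorm]
    refine ne_top_of_le_ne_top (b := ∫⁻ ξ, M * ‖wave t x ξ * fourierHat g ξ‖ₑ) ?_
      (lintegral_mono_ae ?_)
    · rw [lintegral_const_mul' _ _ hM]
      exact ENNReal.mul_ne_top hM hwave.hasFiniteIntegral.ne
    · filter_upwards [Measure.ae_ne volume 0] with ξ hξ
      simp only [mul_left_comm (wave t x ξ), enorm_mul, ENNReal.tsum_mul_right]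
      gcongr
      exact hle ξ hξ
  rw [← integral_tsum hmeas hfinite]
  refine integral_congr_ae ?_
  filter_upwards [Measure.ae_ne volume 0] with ξ hξ
  have hone := Complex.hasSum_ofReal.2 (hsum ξ hξ)
  rw [((hone.mul_right (fourierHat g ξ)).mul_left (wave t x ξ)).tsum_eq, Complex.ofReal_one,
    one_mul, wave]

theorem besovNorm_three_one_one (φ : Plane → ℝ) (g : Plane → ℂ) :
    besovNorm φ 3 1 1 g
      = ∑' j : ℤ, ENNReal.ofReal (((2 : ℝ) ^ j) ^ 3) * eLpNorm (lpProj φ j g) 1 volume := by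
  rw [besovNorm, eLpNorm_one_eq_lintegral_enorm, lintegral_count]
  refine tsum_congr fun j ↦ ?_
  have hpow : (2 : ℝ≥0∞) ^ (3 * (j : ℝ)) = ENNReal.ofReal (((2 : ℝ) ^ j) ^ 3) := by
    rw [← ENNReal.ofReal_ofNat 2, ENNReal.ofReal_rpow_of_pos two_pos, mul_comm,
      Real.rpow_mul two_pos.le, Real.rpow_intCast, Real.rpow_ofNat]
  rw [enorm_eq_self, hpow]

end LittlewoodPaley

end BetaPlane

theorem proposition5p1_general :
    ∃ C : ℝ, 0 < C ∧ ∀ φ : BetaPlane.Plane → ℝ, Continuous φ →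
      Function.support φ ⊆ {ξ | 1 / 2 ≤ ‖ξ‖ ∧ ‖ξ‖ ≤ 2} →
      (∀ ξ, ξ ≠ 0 → HasSum (fun j : ℤ ↦ φ ((2 : ℝ) ^ (-j) • ξ)) 1) →
      ∀ g : BetaPlane.Plane → ℂ, Integrable g → Integrable (BetaPlane.fourierHat g) →
      ∀ t : ℝ, 0 < t →
        eLpNorm (BetaPlane.semigroup t g) ∞ volume
          ≤ ENNReal.ofReal (C * t⁻¹) * BetaPlane.besovNorm φ 3 1 1 g := by
  obtain ⟨C, hC, hdispersive⟩ := BetaPlane.exists_enorm_integral_wave_mul_dilate_le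
  refine ⟨C, hC, fun φ hφ hsupp hsum g hg hghat t ht ↦ ?_⟩
  rw [eLpNorm_exponent_top, BetaPlane.besovNorm_three_one_one, ← ENNReal.tsum_mul_left]
  refine eLpNormEssSup_le_of_ae_enorm_bound (.of_forall fun x ↦ ?_)
  rw [BetaPlane.semigroup_eq_tsum hφ hsupp hsum hghat t x]
  refine enorm_tsum_le_tsum_enorm.trans (ENNReal.tsum_le_tsum fun j ↦ ?_)
  rw [← mul_assoc, ← ENNReal.ofReal_mul (by positivity)]
  exact hdispersive t ht φ hφ hsupp g hg x j

theorem proposition5p1 (φ : BetaPlane.Plane → ℝ) (hφ : BetaPlane.IsLittlewoodPaleyBump φ) :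
    ∃ C : ℝ, 0 < C ∧ ∀ g : BetaPlane.Plane → ℂ, ContDiff ℝ ∞ g → HasCompactSupport g →
      ∀ t : ℝ, 0 < t →
        eLpNorm (BetaPlane.semigroup t g) ∞ volume
          ≤ ENNReal.ofReal (C * t⁻¹) * BetaPlane.besovNorm φ 3 1 1 g := by
  obtain ⟨C, hC, hdecay⟩ := proposition5p1_general
  exact ⟨C, hC, fun g hg hc ↦ hdecay φ hφ.smooth.continuous hφ.support_subset hφ.hasSum_one g
    (hg.continuous.integrable_of_hasCompactSupport hc) (BetaPlane.integrable_fourierHat hg hc)⟩
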